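/- Let $n,m,p$ be integers with $0\le m<n$ and $3\le p\le n$, let $s\in(0,1]$, let $C\in\mathbb{R}^{n\times n}$ be a cost matrix and $r^1,r^2\in\mathbb{R}^n$ marginals. For $X\in\mathbb{R}^{n\times n}$ let $\mathrm{vec}(X)\in\mathbb{R}^{n^2}$ be the vector of its stacked columns, and let $c=\mathrm{vec}(C)$. Consider the optimal transport linear program $$\min_{x\in\mathbb{R}^{n^2}} c^Tx\quad\text{subject to}\quad Ax=b,\ x\ge 0,\qquad b=\begin{pmatrix}r^1\\ r^2\end{pmatrix},$$ where $A\in\mathbb{R}^{2n\times n^2}$ is the matrix for which $A\,\mathrm{vec}(X)$ lists the row sums of $X$ followed by its column sums. Let $\mathcal{N}$ be the set of all $n^2$ coordinates. For a feasible $x$ and $\mathcal{I}\subseteq\mathcal{N}$ let $q(x;\mathcal{I})$ be the minimum, and $\mathcal{D}(x;\mathcal{I})$ the set of minimizers, of $c^Td$ over all $d\in\mathbb{R}^{n^2}$ with $x+d\ge 0$, $Ad=0$ and $d_i=0$ for $i\notin\mathcal{I}$. The algorithm RBCD-SDB starts from a (possibly random) feasible $x^0$. For $k=0,1,2,\dots$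 it chooses a random working set $\mathcal{I}_k\subseteq\mathcal{N}$, independently of $\mathcal{F}_k=\sigma(x^0,\dots,x^k)$, then finds $d^k\in\mathcal{D}(x^k;\mathcal{I}_k)$ and sets $x^{k+1}=x^k+d^k$. The law of $\mathcal{I}_k$ is the following mixture. * With probability $s$ (diagonal band): $\mathcal{I}_k$ is the support of the vectorization of the matrix obtained by permuting the rows and the columns of $G$ by two independent uniformly random permutations. Here $G$ is the $n\times n$ matrix of zeros and ones whose ones are the positions $(i,j)$ with $i\in[j,j+p-1]$ if $j\le n-p+1$, and with $i\in[1,j+p-n-1]\cup[j,n]$ if $j\ge n-p+2$. * With probability $1-s$ (submatrix): $\mathcal{I}_k$ is the set of positions of the $m\times m$ submatrix whose set of $m$ rows and set of $m$ columns are chosen independently and uniformly at random. **Theorem.** For the sequences $\{x^k\}$ and $\{\mathcal{I}_k\}$ generated by RBCD-SDB there is a constant $$v\in(0,1],\qquad v\ \ge\ \frac{s\,n\,(p-2)}{(n^2-3)\,(n!)^2},$$ with which the expected Gauss–Southwell-$q$ rule holds: for all $k\ge0$, $$\mathbb{E}\bigl[q(x^k;\mathcal{I}_k)\mid\mathcal{F}_k\bigr]\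 \le\ v\,q(x^k;\mathcal{N})\quad\text{almost surely.}$$ Moreover, with this $v$, for every optimal solution $x^*$ of the linear program, $c^T(x^k-x^*)\to0$ almost surely, $\mathbb{E}[c^T(x^k-x^*)]\le(1-v)^k\,\mathbb{E}[c^T(x^0-x^*)]$ for all $k\ge0$, and consequently $\mathbb{E}[c^T(x^k-x^*)]\to0$. -/

import Mathlib

open MeasureTheory ProbabilityTheory Filter Topology

noncomputable section

namespace RBCD

/-! ### The standard linear program `min cᵀx` subject to `Ax = b`, `x ≥ 0` -/

section LP

variable {κ ι : Type*} [Fintype ι]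

/-- The feasible set `{x | A x = b, x ≥ 0}`. -/
def feasibleSet (A : Matrix κ ι ℝ) (b : κ → ℝ) : Set (ι → ℝ) :=
  {x | A.mulVec x = b ∧ 0 ≤ x}

/-- The set of optimal solutions of the linear program. -/
def optimalSet (A : Matrix κ ι ℝ) (b : κ → ℝ) (c : ι → ℝ) : Set (ι → ℝ) :=
  {x | x ∈ feasibleSet A b ∧ ∀ y ∈ feasibleSet A b, c ⬝ᵥ x ≤ c ⬝ᵥ y}

/-- The directions admitted by the subproblem at `x` with working set `I`:
`x + d ≥ 0`, `A d = 0` and `d i = 0` for `i ∉ I`. -/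
def directions (A : Matrix κ ι ℝ) (x : ι → ℝ) (I : Finset ι) : Set (ι → ℝ) :=
  {d | 0 ≤ x + d ∧ A.mulVec d = 0 ∧ ∀ i, i ∉ I → d i = 0}

/-- `𝒟(x; I)`: the set of minimizers of `cᵀd` over the admitted directions. -/
def argminDirections (A : Matrix κ ι ℝ) (c : ι → ℝ) (x : ι → ℝ) (I : Finset ι) :
    Set (ι → ℝ) :=
  {d | d ∈ directions A x I ∧ ∀ e ∈ directions A x I, c ⬝ᵥ d ≤ c ⬝ᵥ e}

/-- `q(x; I)`: the minimal value of `cᵀd` over the admitted directions. -/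
def q (A : Matrix κ ι ℝ) (c : ι → ℝ) (x : ι → ℝ) (I : Finset ι) : ℝ :=
  sInf ((fun d => c ⬝ᵥ d) '' directions A x I)

/-- The history `𝓕ₖ`: the σ-algebra generated by `x⁰, …, xᵏ`. -/
abbrev history {Ω : Type*} (x : ℕ → Ω → ι → ℝ) (k : ℕ) : MeasurableSpace Ω :=
  ⨆ j ∈ Finset.range (k + 1), MeasurableSpace.comap (x j) inferInstance

/-- The expected Gauss–Southwell-`q` rule with constant `v ∈ (0, 1]`:
`𝔼[q(xᵏ; Iₖ) | 𝓕ₖ] ≤ v q(xᵏ; 𝒩)` almost surely, for every `k`. -/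
def ExpectedGaussSouthwellQ {Ω : Type*} [MeasurableSpace Ω] (μ : Measure Ω)
    (A : Matrix κ ι ℝ) (c : ι → ℝ) (x : ℕ → Ω → ι → ℝ) (I : ℕ → Ω → Finset ι)
    (v : ℝ) : Prop :=
  0 < v ∧ v ≤ 1 ∧ ∀ k,
    Integrable (fun ω => q A c (x k ω) (I k ω)) μ ∧
    μ[fun ω => q A c (x k ω) (I k ω) | history x k]
      ≤ᵐ[μ] fun ω => v * q A c (x k ω) Finset.univ

end LP

/-! ### The optimal transport constraints

Matrices are vectorized by Mathlib's `Matrix.vec`, which stacks columns: the entry `(i, j)` of `X`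
is the coordinate `(j, i)` of `X.vec` (entry `i` of block `j`). -/

/-- The `2n × n²` constraint matrix: the upper half is `(Iₙ Iₙ ⋯ Iₙ)`, the lower half is block
diagonal with `n` blocks `1ₙᵀ`. -/
def otMatrix (n : ℕ) : Matrix (Fin n ⊕ Fin n) (Fin n × Fin n) ℝ :=
  Matrix.fromRows
    (Matrix.of fun a ji => if a = ji.2 then 1 else 0)
    (Matrix.of fun a ji => if a = ji.1 then 1 else 0)

/-- The right-hand side `((r¹)ᵀ, (r²)ᵀ)ᵀ`. -/
def otRhs {n : ℕ} (r₁ r₂ : Fin n → ℝ) : Fin n ⊕ Fin n → ℝ := Sum.elim r₁ r₂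

/-- The support of the vectorization of a matrix. -/
def vecSupport {n : ℕ} (D : Matrix (Fin n) (Fin n) ℝ) : Finset (Fin n × Fin n) :=
  {ji | D.vec ji ≠ 0}

/-! ### Random working sets -/

/-- The set of positions of the diagonal band of width `p`, for row and column numbers
`i, j ∈ {1, …, n}`: `i ∈ [j, j+p-1]` if `j ≤ n-p+1`, and `i ∈ [1, j+p-n-1] ∪ [j, n]` if
`j ≥ n-p+2`. The inequalities are written without subtraction. -/
def InBand (n p i j : ℕ) : Prop :=
  (j + p ≤ n + 1 ∧ j ≤ i ∧ i + 1 ≤ j + p) ∨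
  (n + 2 ≤ j + p ∧ (i + n + 1 ≤ j + p ∨ j ≤ i))

open Classical in
/-- The `0`-`1` matrix `G` of the diagonal band of width `p`. -/
def bandMatrix (n p : ℕ) : Matrix (Fin n) (Fin n) ℝ :=
  Matrix.of fun i j => if InBand n p (i + 1) (j + 1) then 1 else 0

/-- Law of the diagonal band working set: the support of `G` after its rows and its columns have
been permuted uniformly at random. -/
def bandLaw (n p : ℕ) : PMF (Finset (Fin n × Fin n)) :=
  (PMF.uniformOfFintype (Equiv.Perm (Fin n) × Equiv.Perm (Fin n))).map
    fun π => vecSupport ((bandMatrix n p).submatrix π.1 π.2)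

/-- The indicator matrix of the submatrix with row set `R` and column set `S`. -/
def blockMatrix {n : ℕ} (R S : Finset (Fin n)) : Matrix (Fin n) (Fin n) ℝ :=
  Matrix.of fun i j => if i ∈ R ∧ j ∈ S then 1 else 0

theorem powersetCard_prod_nonempty {n m : ℕ} (hm : m ≤ n) :
    ((Finset.univ : Finset (Fin n)).powersetCard m ×ˢ
      (Finset.univ : Finset (Fin n)).powersetCard m).Nonempty := by
  have h : ((Finset.univ : Finset (Fin n)).powersetCard m).Nonempty :=
    Finset.powersetCard_nonempty.mpr (by simpa using hm)
  exact h.product h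

/-- Law of the submatrix working set: the support of an `m × m` submatrix, whose row set and
column set are chosen uniformly at random among all pairs of `m`-element sets. -/
def submatrixLaw (n m : ℕ) (hm : m ≤ n) : PMF (Finset (Fin n × Fin n)) :=
  (PMF.uniformOfFinset _ (powersetCard_prod_nonempty hm)).map
    fun RS => vecSupport (blockMatrix RS.1 RS.2)

/-- Probability that the mixed selection rule yields the working set `S`: with probability `s` the
diagonal band is used, otherwise the submatrix. -/
def mixedProb (n m p : ℕ) (hm : m ≤ n) (s : ℝ) (S : Finset (Fin n × Fin n)) : ENNReal :=
  ENNReal.ofReal s * bandLaw n p S + ENNReal.ofReal (1 - s) * submatrixLaw n m hm S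

/-! ### The algorithm -/

/-- The random sequences `x` (iterates), `I` (working sets) and `d` (steps) are generated by random
block coordinate descent with submatrix and diagonal band, with submatrix dimension `m`, band
width `p` and selection parameter `s`, applied to the optimal transport problem with cost
matrix `C` and marginals `r₁`, `r₂`. -/
structure IsRBCDSDB {Ω : Type*} [MeasurableSpace Ω] (μ : Measure Ω) {n : ℕ} (m p : ℕ)
    (hm : m ≤ n) (s : ℝ) (C : Matrix (Fin n) (Fin n) ℝ) (r₁ r₂ : Fin n → ℝ)
    (x : ℕ → Ω → Fin n × Fin n → ℝ) (I : ℕ → Ω → Finset (Fin n × Fin n))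
    (d : ℕ → Ω → Fin n × Fin n → ℝ) : Prop where
  /-- The iterates are random vectors. -/
  measurable_x : ∀ k, Measurable (x k)
  /-- The working sets are random sets. -/
  measurable_I : ∀ k, Measurable[_, ⊤] (I k)
  /-- Initialization: the starting point is feasible. -/
  init : ∀ ω, x 0 ω ∈ feasibleSet (otMatrix n) (otRhs r₁ r₂)
  /-- Step 1: the working set has the law of the mixed selection rule … -/
  law_I : ∀ k S, μ {ω | I k ω = S} = mixedProb n m p hm s S
  /-- … and its choice is independent of the iterates computed so far. -/
  indep_I : ∀ k, Indep (MeasurableSpace.comap (I k) ⊤) (history x k) μ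
  /-- Step 2: the step solves the subproblem. -/
  step : ∀ k ω, d k ω ∈ argminDirections (otMatrix n) C.vec (x k ω) (I k ω)
  /-- Step 3: the update. -/
  update : ∀ k ω, x (k + 1) ω = x k ω + d k ω

end RBCD

end

/-!
The constant is `v = s n (p - 2) / ((n² - 3) (n!)²)` itself.

Let `d` be an optimal direction at a feasible point `x` for the full working set. It has zero row
and column sums, so it is a conformal (sign-compatible) sum of multiples of alternating cycles.
Splitting off a cycle cancels at least one nonzero entry, and the last cycle has at least four, so at
most `n² - 3` cycles occur, and one of them, `e`, satisfies `(n² - 3) cᵀe ≤ cᵀd`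
(`exists_cycle`, `exists_foldable_descent`). Since `e` is sign-compatible with `d`, it is a feasible
direction at `x`, for every working set that contains its support.

An alternating cycle, folded in half, fits into a tridiagonal band after a renumbering of rows
and columns (`exists_folding`). A band of width `p` contains `p - 2` bands of width three, and it
is invariant under the `n` simultaneous rotations of rows and columns, so at least `n (p - 2)` of the
`(n!)²` pairs of permutations move the band over the support of `e` (`card_perm_band_le`). Hence the
working set contains this support with probability at least `s n (p - 2) / (n!)²`, which gives the
Gauss–Southwell-`q` inequality at a fixed point (`sum_mixedProb_mul_q_le`). Independence of the
working set from the past turns it into the inequality for conditional expectations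
(`condExp_q_eq`); this requires the value function of the subproblem to be measurable, which follows
from compactness of the transport polytope (`measurable_q`).

Since `-q(x; 𝒩)` is the optimality gap at `x`, the mean gap contracts by the factor `1 - v` in each step. The
gap decreases along every trajectory, so it tends to zero almost surely as well
(`ExpectedGaussSouthwellQ.convergence`).
-/

namespace RBCD

/-! ### Subproblems of a linear program with compact feasible set -/

section LinearProgram

variable {κ ι : Type*} [Fintype ι] {A : Matrix κ ι ℝ} {b : κ → ℝ} {c x d : ι → ℝ}
  {I : Finset ι}

theorem add_mem_feasibleSet (hx : x ∈ feasibleSet A b) (hd : d ∈ directions A x I) :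
    x + d ∈ feasibleSet A b :=
  ⟨by rw [Matrix.mulVec_add, hd.2.1, hx.1, add_zero], hd.1⟩

theorem mem_directions_iff (hx : x ∈ feasibleSet A b) :
    d ∈ directions A x I ↔ x + d ∈ feasibleSet A b ∧ ∀ i, i ∉ I → d i = 0 := by
  refine ⟨fun hd => ⟨add_mem_feasibleSet hx hd, hd.2.2⟩, fun hd => ⟨hd.1.2, ?_, hd.2⟩⟩
  have h := hd.1.1
  rwa [Matrix.mulVec_add, hx.1, add_eq_left] at h

theorem zero_mem_directions (hx : x ∈ feasibleSet A b) : (0 : ι → ℝ) ∈ directions A x I :=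
  (mem_directions_iff hx).2 ⟨by simpa using hx, fun _ _ => rfl⟩

theorem isClosed_feasibleSet (A : Matrix κ ι ℝ) (b : κ → ℝ) : IsClosed (feasibleSet A b) := by
  have h1 : IsClosed {x : ι → ℝ | A.mulVec x = b} :=
    isClosed_eq (continuous_const.matrix_mulVec continuous_id) continuous_const
  exact h1.inter isClosed_Ici

theorem isClosed_directions (A : Matrix κ ι ℝ) (x : ι → ℝ) (I : Finset ι) :
    IsClosed (directions A x I) := by
  have h1 : IsClosed {d : ι → ℝ | 0 ≤ x + d} := isClosed_le continuous_const (by fun_prop)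
  have h2 : IsClosed {d : ι → ℝ | A.mulVec d = 0} :=
    isClosed_eq (continuous_const.matrix_mulVec continuous_id) continuous_const
  have h3 : IsClosed {d : ι → ℝ | ∀ i, i ∉ I → d i = 0} := by
    simp only [Set.ofPred_forall]
    exact isClosed_iInter fun i => isClosed_iInter fun _ =>
      isClosed_eq (continuous_apply i) continuous_const
  exact h1.inter (h2.inter h3)

theorem isCompact_directions (hK : IsCompact (feasibleSet A b)) (hx : x ∈ feasibleSet A b) :
    IsCompact (directions A x I) := by
  refine (hK.image (continuous_id.sub continuous_const : Continuous fun y => y - x)).of_isClosed_subset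
    (isClosed_directions A x I) fun d hd => ⟨x + d, add_mem_feasibleSet hx hd, by simp⟩

theorem continuous_cost (c : ι → ℝ) : Continuous fun d : ι → ℝ => c ⬝ᵥ d := by
  unfold dotProduct; fun_prop

theorem argminDirections_nonempty (hK : IsCompact (feasibleSet A b)) (hx : x ∈ feasibleSet A b) :
    (argminDirections A c x I).Nonempty := by
  obtain ⟨d, hd, hmin⟩ := (isCompact_directions (I := I) hK hx).exists_isMinOn
    ⟨0, zero_mem_directions hx⟩ (continuous_cost c).continuousOn
  exact ⟨d, hd, fun e he => hmin he⟩

theorem q_eq_of_mem_argminDirections (hd : d ∈ argminDirections A c x I) :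
    q A c x I = c ⬝ᵥ d :=
  IsLeast.csInf_eq ⟨⟨d, hd.1, rfl⟩, by rintro _ ⟨e, he, rfl⟩; exact hd.2 e he⟩

theorem q_le (hK : IsCompact (feasibleSet A b)) (hx : x ∈ feasibleSet A b)
    (hd : d ∈ directions A x I) : q A c x I ≤ c ⬝ᵥ d := by
  obtain ⟨e, he⟩ := argminDirections_nonempty (c := c) (I := I) hK hx
  rw [q_eq_of_mem_argminDirections he]
  exact he.2 d hd

theorem q_nonpos (hK : IsCompact (feasibleSet A b)) (hx : x ∈ feasibleSet A b) :
    q A c x I ≤ 0 := by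
  simpa using q_le (c := c) hK hx (zero_mem_directions (I := I) hx)

theorem q_univ_eq {xstar : ι → ℝ} (hx : x ∈ feasibleSet A b) (hs : xstar ∈ optimalSet A b c) :
    q A c x Finset.univ = -(c ⬝ᵥ (x - xstar)) := by
  have h : xstar - x ∈ argminDirections A c x Finset.univ := by
    refine ⟨(mem_directions_iff hx).2 ⟨by simpa using hs.1, by simp⟩, fun e he => ?_⟩
    have := hs.2 _ (add_mem_feasibleSet hx he)
    rw [dotProduct_add] at this
    rw [dotProduct_sub]
    linarith
  rw [q_eq_of_mem_argminDirections h, ← dotProduct_neg, neg_sub]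

/-- The value function of the subproblem is measurable on a compact feasible set: its sublevel sets
are projections of compact sets, because the minimum is attained. -/
theorem measurable_q (hK : IsCompact (feasibleSet A b)) (c : ι → ℝ) (I : Finset ι) :
    Measurable fun y : feasibleSet A b => q A c y I := by
  refine measurable_of_Iic fun a => ?_
  -- `Z` consists of the pairs `(y, y + d)` with `d` admitted at `y` and of cost at most `a`.
  let Z : Set ((ι → ℝ) × (ι → ℝ)) :=
    (feasibleSet A b ×ˢ feasibleSet A b) ∩ {z | (∀ i, i ∉ I → z.1 i = z.2 i) ∧
      c ⬝ᵥ (z.2 - z.1) ≤ a}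
  have hZ : IsCompact Z := by
    have h1 : IsClosed {z : (ι → ℝ) × (ι → ℝ) | ∀ i, i ∉ I → z.1 i = z.2 i} := by
      simp only [Set.ofPred_forall]
      exact isClosed_iInter fun i => isClosed_iInter fun _ =>
        isClosed_eq (by fun_prop) (by fun_prop)
    have h2 : IsClosed {z : (ι → ℝ) × (ι → ℝ) | c ⬝ᵥ (z.2 - z.1) ≤ a} :=
      isClosed_le ((continuous_cost c).comp (by fun_prop)) continuous_const
    exact (hK.prod hK).inter_right (h1.inter h2)
  have h : (fun y : feasibleSet A b => q A c y I) ⁻¹' Set.Iic a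
      = Subtype.val ⁻¹' (Prod.fst '' Z) := by
    ext ⟨y, hy⟩
    simp only [Set.mem_preimage, Set.mem_Iic]
    constructor
    · intro hq
      obtain ⟨e, he⟩ := argminDirections_nonempty (c := c) (I := I) hK hy
      rw [q_eq_of_mem_argminDirections he] at hq
      refine ⟨(y, y + e), ⟨⟨hy, add_mem_feasibleSet hy he.1⟩, fun i hi => ?_, ?_⟩, rfl⟩
      · simp [he.1.2.2 i hi]
      · simpa using hq
    · rintro ⟨⟨y', z⟩, ⟨⟨h1, h2⟩, h3, h4⟩, rfl⟩
      refine (q_le hK hy ((mem_directions_iff hy).2 ⟨by simpa using h2, fun i hi => ?_⟩)).trans h4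
      exact sub_eq_zero.2 (h3 i hi).symm
  rw [h]
  exact measurable_subtype_coe (hZ.image continuous_fst).isClosed.measurableSet

end LinearProgram

/-! ### The transport polytope -/

section Transport

variable {n : ℕ}

theorem otMatrix_mulVec_inl (d : Fin n × Fin n → ℝ) (i : Fin n) :
    (otMatrix n).mulVec d (Sum.inl i) = ∑ j, d (j, i) := by
  simp [otMatrix, Matrix.mulVec, dotProduct, Fintype.sum_prod_type]

theorem otMatrix_mulVec_inr (d : Fin n × Fin n → ℝ) (j : Fin n) :
    (otMatrix n).mulVec d (Sum.inr j) = ∑ i, d (j, i) := by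
  simp [otMatrix, Matrix.mulVec, dotProduct, Fintype.sum_prod_type_right]

theorem otMatrix_mulVec_eq_zero_iff {d : Fin n × Fin n → ℝ} :
    (otMatrix n).mulVec d = 0 ↔ (∀ i, ∑ j, d (j, i) = 0) ∧ ∀ j, ∑ i, d (j, i) = 0 := by
  simp [funext_iff, otMatrix_mulVec_inl, otMatrix_mulVec_inr]

theorem isCompact_feasibleSet_otMatrix (b : Fin n ⊕ Fin n → ℝ) :
    IsCompact (feasibleSet (otMatrix n) b) := by
  refine (isCompact_univ_pi fun ji : Fin n × Fin n =>
    isCompact_Icc (a := (0 : ℝ)) (b := b (Sum.inl ji.2))).of_isClosed_subset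
    (isClosed_feasibleSet _ _) ?_
  rintro x ⟨hx, h0⟩ ⟨j, i⟩ -
  refine ⟨h0 _, ?_⟩
  rw [← hx, otMatrix_mulVec_inl]
  exact Finset.single_le_sum (f := fun j => x (j, i)) (fun j _ => h0 (j, i)) (Finset.mem_univ j)

end Transport


/-! ### Conformal decomposition into cycles -/

/-- A vector of `ℝ^(n²)` is *foldable* if its rows and columns can be renumbered so that its
support lies in the tridiagonal band `|i - j| ≤ 1`. -/
def Foldable {n : ℕ} (e : Fin n × Fin n → ℝ) : Prop :=
  ∃ σ τ : Equiv.Perm (Fin n), ∀ j i, e (j, i) ≠ 0 →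
    (σ i : ℕ) ≤ τ j + 1 ∧ (τ j : ℕ) ≤ σ i + 1

theorem Foldable.smul {n : ℕ} {e : Fin n × Fin n → ℝ} (he : Foldable e) (a : ℝ) :
    Foldable (a • e) := by
  obtain ⟨σ, τ, h⟩ := he
  exact ⟨σ, τ, fun j i hji => h j i fun h0 => hji (by simp [h0])⟩

theorem exists_perm_apply_eq {L : ℕ} {α : Type*} {r t : Fin L → α}
    (hr : Function.Injective r) (ht : Function.Injective t) :
    ∃ σ : Equiv.Perm α, ∀ k, σ (r k) = t k := by
  obtain ⟨g, hg⟩ := (Equiv.Perm.isMultiplyPretransitive α L).exists_smul_eq ⟨r, hr⟩ ⟨t, ht⟩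
  exact ⟨g, fun k => by simpa using DFunLike.congr_fun hg k⟩

/-- A closed walk `r 0, f (r 0), r 1, f (r 1), …` of length `2 L` through distinct rows `r k` and
distinct columns `f (r k)` can be folded in the middle: the two vertices at distance `t` from
either end of the walk are given the same number `t`. Consecutive vertices then have
numbers that differ by at most one. -/
theorem exists_folding {n L : ℕ} (r : ℕ → Fin n) (f : Fin n → Fin n)
    (hr : Set.InjOn r (Set.Iio L)) (hf : Set.InjOn (fun k => f (r k)) (Set.Iio L))
    (hL : r L = r 0) :
    ∃ σ τ : Equiv.Perm (Fin n), ∀ k < L,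
      ((σ (r k) : ℕ) ≤ τ (f (r k)) + 1 ∧ (τ (f (r k)) : ℕ) ≤ σ (r k) + 1) ∧
      ((σ (r (k + 1)) : ℕ) ≤ τ (f (r k)) + 1 ∧ (τ (f (r k)) : ℕ) ≤ σ (r (k + 1)) + 1) := by
  have hr' : Function.Injective fun k : Fin L => r k := fun a b h => Fin.ext (hr a.2 b.2 h)
  have hf' : Function.Injective fun k : Fin L => f (r k) := fun a b h => Fin.ext (hf a.2 b.2 h)
  have hLn : L ≤ n := by simpa using Fintype.card_le_of_injective _ hr'
  -- In the closed walk row `r k` is vertex `2 k` and column `f (r k)` is vertex `2 k + 1` of `2 L`;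
  -- the two numbers in each minimum are the distances to the two ends. No subtraction truncates.
  obtain ⟨σ, hσ⟩ := exists_perm_apply_eq hr'
    (t := fun k : Fin L => (⟨min (2 * k) (2 * L - 1 - 2 * k), by omega⟩ : Fin n))
    (fun a b h => by simp only [Fin.mk.injEq] at h; ext; omega)
  obtain ⟨τ, hτ⟩ := exists_perm_apply_eq hf'
    (t := fun k : Fin L => (⟨min (2 * k + 1) (2 * L - 2 - 2 * k), by omega⟩ : Fin n))
    (fun a b h => by simp only [Fin.mk.injEq] at h; ext; omega)
  refine ⟨σ, τ, fun k hk => ?_⟩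
  have h1 := congrArg Fin.val (hσ ⟨k, hk⟩)
  have h2 := congrArg Fin.val (hτ ⟨k, hk⟩)
  simp only at h1 h2
  refine ⟨by omega, ?_⟩
  rcases Nat.lt_or_ge (k + 1) L with hk' | hk'
  · have h3 := congrArg Fin.val (hσ ⟨k + 1, hk'⟩)
    simp only at h3
    omega
  · have h3 := congrArg Fin.val (hσ ⟨0, by omega⟩)
    obtain rfl : L = k + 1 := by omega
    rw [hL]
    simp only at h3
    omega

theorem exists_pos_of_sum_eq_zero {ι : Type*} [Fintype ι] {u : ι → ℝ} (h : ∑ i, u i = 0)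
    {i : ι} (hi : u i < 0) : ∃ i', 0 < u i' := by
  by_contra! hu
  have := Finset.sum_lt_sum (s := Finset.univ) (fun j _ => hu j) ⟨i, Finset.mem_univ i, hi⟩
  simp [h] at this

theorem exists_neg_of_sum_eq_zero {ι : Type*} [Fintype ι] {u : ι → ℝ} (h : ∑ i, u i = 0)
    {i : ι} (hi : 0 < u i) : ∃ i', u i' < 0 := by
  obtain ⟨i', hi'⟩ := exists_pos_of_sum_eq_zero (u := -u) (by simp [h]) (i := i) (by simpa using hi)
  exact ⟨i', by simpa using hi'⟩

/-- A nonzero vector with zero row and column sums carries an alternating cycle. Following, from a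
row, a positive entry to its column and then a negative entry of that column to another row
defines a self-map of the rows with a nonzero entry, and a periodic orbit of this map is the cycle.
Its rows are distinct, and hence so are its columns, since the column determines the next row. -/
theorem exists_cycle {n : ℕ} {d : Fin n × Fin n → ℝ} (hd : (otMatrix n).mulVec d = 0)
    (hne : d ≠ 0) :
    ∃ e : Fin n × Fin n → ℝ, (otMatrix n).mulVec e = 0 ∧ e ≠ 0 ∧ Foldable e ∧
      ∀ ji, (0 < e ji → 0 < d ji) ∧ (e ji < 0 → d ji < 0) := by
  obtain ⟨hrow, hcol⟩ := otMatrix_mulVec_eq_zero_iff.1 hd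
  have hf : ∀ i, ∃ j, (∃ j', d (j', i) < 0) → 0 < d (j, i) := fun i => by
    by_cases h : ∃ j', d (j', i) < 0
    · obtain ⟨j', hj'⟩ := h
      obtain ⟨j, hj⟩ := exists_pos_of_sum_eq_zero (hrow i) hj'
      exact ⟨j, fun _ => hj⟩
    · exact ⟨i, fun h' => absurd h' h⟩
  have hg : ∀ j, ∃ i, (∃ i', 0 < d (j, i')) → d (j, i) < 0 := fun j => by
    by_cases h : ∃ i', 0 < d (j, i')
    · obtain ⟨i', hi'⟩ := h
      obtain ⟨i, hi⟩ := exists_neg_of_sum_eq_zero (hcol j) hi'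
      exact ⟨i, fun _ => hi⟩
    · exact ⟨j, fun h' => absurd h' h⟩
  -- `f` picks a positive entry in each row and `g` a negative entry in each column that has one; on
  -- zero rows and columns their values are irrelevant.
  choose f hf using hf
  choose g hg using hg
  let h : Fin n → Fin n := fun i => g (f i)
  obtain ⟨i₁, hi₁⟩ : ∃ i, ∃ j, d (j, i) < 0 := by
    obtain ⟨⟨j, i⟩, hji⟩ := Function.ne_iff.1 hne
    rcases lt_or_gt_of_ne hji with hlt | hgt
    · exact ⟨i, j, hlt⟩
    · obtain ⟨i', hi'⟩ := exists_neg_of_sum_eq_zero (hcol j) hgt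
      exact ⟨i', j, hi'⟩
  have hneg : ∀ k, ∃ j, d (j, h^[k] i₁) < 0 := by
    intro k
    induction k with
    | zero => exact hi₁
    | succ k ih =>
      rw [Function.iterate_succ_apply']
      exact ⟨_, hg _ ⟨_, hf _ ih⟩⟩
  obtain ⟨a, b, hab, heq⟩ : ∃ a b : ℕ, a < b ∧ h^[a] i₁ = h^[b] i₁ := by
    obtain ⟨a, b, hab, heq⟩ := Finite.exists_ne_map_eq_of_infinite fun k : ℕ => h^[k] i₁
    rcases lt_or_gt_of_ne hab with hlt | hgt
    · exact ⟨a, b, hlt, heq⟩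
    · exact ⟨b, a, hgt, heq.symm⟩
  let i₀ := h^[a] i₁
  have hper : i₀ ∈ Function.periodicPts h := by
    refine ⟨b - a, by omega, ?_⟩
    change h^[b - a] (h^[a] i₁) = h^[a] i₁
    rw [← Function.iterate_add_apply, Nat.sub_add_cancel hab.le, heq]
  let L := Function.minimalPeriod h i₀
  have hL0 : 0 < L := Function.minimalPeriod_pos_of_mem_periodicPts hper
  let r : ℕ → Fin n := fun k => h^[k] i₀
  have hsucc : ∀ k, r (k + 1) = g (f (r k)) := fun k => Function.iterate_succ_apply' h k i₀
  have hrL : r L = r 0 := Function.iterate_minimalPeriod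
  have hrinj : Set.InjOn r (Set.Iio L) := Function.iterate_injOn_Iio_minimalPeriod
  have hfinj : Set.InjOn (fun k => f (r k)) (Set.Iio L) := by
    intro k hk l hl hkl
    have h1 : r (k + 1) = r (l + 1) := by rw [hsucc, hsucc]; exact congrArg g hkl
    have hk : k < L := hk
    have hl : l < L := hl
    rcases Nat.lt_or_ge (k + 1) L with hk' | hk' <;> rcases Nat.lt_or_ge (l + 1) L with hl' | hl'
    · have := hrinj hk' hl' h1
      omega
    · rw [show l + 1 = L by omega, hrL] at h1
      have := hrinj hk' hL0 h1
      omega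
    · rw [show k + 1 = L by omega, hrL] at h1
      have := hrinj hL0 hl' h1
      omega
    · omega
  have hpos : ∀ k, 0 < d (f (r k), r k) := fun k => by
    refine hf _ ?_
    have := hneg (k + a)
    rwa [Function.iterate_add_apply] at this
  have hng : ∀ k, d (f (r k), r (k + 1)) < 0 := fun k => by
    rw [hsucc]
    exact hg _ ⟨_, hpos k⟩
  let e : Fin n × Fin n → ℝ := fun ji => ∑ k ∈ Finset.range L,
    ((if ji = (f (r k), r k) then 1 else 0) - (if ji = (f (r k), r (k + 1)) then 1 else 0))
  -- The two kinds of positions are disjoint, as `d` has opposite signs on them, so the sign of an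
  -- entry of `e` tells its kind.
  have he0 : ∀ ji, (0 < e ji → ∃ k < L, ji = (f (r k), r k)) := fun ji hji => by
    by_contra! hk
    refine hji.not_ge (Finset.sum_nonpos fun k hkL => ?_)
    rw [if_neg (hk k (Finset.mem_range.1 hkL))]
    split_ifs <;> norm_num
  have he1 : ∀ ji, (e ji < 0 → ∃ k < L, ji = (f (r k), r (k + 1))) := fun ji hji => by
    by_contra! hk
    refine hji.not_ge (Finset.sum_nonneg fun k hkL => ?_)
    rw [if_neg (hk k (Finset.mem_range.1 hkL))]
    split_ifs <;> norm_num
  refine ⟨e, otMatrix_mulVec_eq_zero_iff.2 ⟨fun i => ?_, fun j => ?_⟩, ?_, ?_, fun ji => ⟨?_, ?_⟩⟩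
  · -- The row sums telescope along the closed walk.
    have hk : ∀ k, ∑ j, ((if ((j, i) : Fin n × Fin n) = (f (r k), r k) then (1 : ℝ) else 0) -
        (if ((j, i) : Fin n × Fin n) = (f (r k), r (k + 1)) then 1 else 0)) =
        (if i = r k then 1 else 0) - if i = r (k + 1) then 1 else 0 := fun k => by
      simp [Prod.ext_iff, ite_and]
    simp only [e]
    rw [Finset.sum_comm, Finset.sum_congr rfl fun k _ => hk k,
      Finset.sum_range_sub' (fun k => if i = r k then (1 : ℝ) else 0), hrL, sub_self]
  · simp only [e]
    rw [Finset.sum_comm]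
    refine Finset.sum_eq_zero fun k _ => ?_
    by_cases hj : j = f (r k) <;> simp [Prod.ext_iff, hj]
  · refine Function.ne_iff.2 ⟨(f (r 0), r 0), ne_of_gt ?_⟩
    refine Finset.sum_pos' (fun k _ => ?_) ⟨0, Finset.mem_range.2 hL0, ?_⟩
    all_goals
      rw [if_neg (c := (f (r 0), r 0) = _)
        fun h0 => (hpos 0).not_gt (h0 ▸ hng _), sub_zero]
    · split_ifs <;> norm_num
    · simp
  · obtain ⟨σ, τ, hστ⟩ := exists_folding r f hrinj hfinj hrL
    refine ⟨σ, τ, fun j i hji => ?_⟩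
    rcases lt_or_gt_of_ne hji with hlt | hgt
    · obtain ⟨k, hk, heq⟩ := he1 _ hlt
      obtain ⟨rfl, rfl⟩ := Prod.mk.inj heq
      exact (hστ k hk).2
    · obtain ⟨k, hk, heq⟩ := he0 _ hgt
      obtain ⟨rfl, rfl⟩ := Prod.mk.inj heq
      exact (hστ k hk).1
  · intro hji
    obtain ⟨k, -, rfl⟩ := he0 _ hji
    exact hpos k
  · intro hji
    obtain ⟨k, -, rfl⟩ := he1 _ hji
    exact hng k

theorem four_le_card_support {n : ℕ} {d : Fin n × Fin n → ℝ} (hd : (otMatrix n).mulVec d = 0)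
    (hne : d ≠ 0) : 4 ≤ (Finset.univ.filter fun ji => d ji ≠ 0).card := by
  obtain ⟨hrow, hcol⟩ := otMatrix_mulVec_eq_zero_iff.1 hd
  have key : ∀ {u : Fin n → ℝ}, ∑ i, u i = 0 → ∀ {i}, u i ≠ 0 → ∃ i', i' ≠ i ∧ u i' ≠ 0 := by
    intro u hu i hi
    by_contra! h
    exact hi (by rwa [Finset.sum_eq_single i (fun b _ hb => h b hb) (by simp)] at hu)
  obtain ⟨⟨j, i⟩, hji⟩ := Function.ne_iff.1 hne
  obtain ⟨j₁, hj₁, h1⟩ := key (hrow i) hji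
  obtain ⟨i₁, hi₁, h2⟩ := key (hcol j) hji
  obtain ⟨j₂, hj₂, h3⟩ := key (hrow i₁) h2
  have hcard : ({(j, i), (j₁, i), (j, i₁), (j₂, i₁)} : Finset (Fin n × Fin n)).card = 4 := by
    rw [Finset.card_insert_of_notMem, Finset.card_insert_of_notMem, Finset.card_insert_of_notMem,
      Finset.card_singleton]
    all_goals simp [*, Ne.symm hi₁, Ne.symm hj₁, Ne.symm hj₂]
  rw [← hcard]
  refine Finset.card_le_card fun ji h => ?_
  simp only [Finset.mem_insert, Finset.mem_singleton] at h
  simp only [Finset.mem_filter_univ]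
  rcases h with rfl | rfl | rfl | rfl <;> assumption

/-- The largest multiple `a • e` of a sign-compatible vector `e` that can be split off `d` without
changing signs cancels an entry of `d`. -/
theorem exists_conformal_smul {ι : Type*} [Fintype ι] {d e : ι → ℝ} (he : e ≠ 0)
    (hsign : ∀ i, (0 < e i → 0 < d i) ∧ (e i < 0 → d i < 0)) :
    ∃ a : ℝ, (∀ i, min 0 (d i) ≤ (a • e) i) ∧ (∀ i, min 0 (d i) ≤ (d - a • e) i) ∧
      (Finset.univ.filter fun i => (d - a • e) i ≠ 0).card <
        (Finset.univ.filter fun i => d i ≠ 0).card := by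
  obtain ⟨i₀, hi₀⟩ := Function.ne_iff.1 he
  obtain ⟨m, hm, hmin⟩ := (Finset.univ.filter fun i => e i ≠ 0).exists_min_image
    (fun i => d i / e i) ⟨i₀, by simpa using hi₀⟩
  have hm : e m ≠ 0 := by simpa using hm
  have hmin : ∀ i, e i ≠ 0 → d m / e m ≤ d i / e i := fun i hi => hmin i (by simpa using hi)
  have ha : 0 < d m / e m := by
    rcases lt_or_gt_of_ne hm with h | h
    · exact div_pos_of_neg_of_neg ((hsign m).2 h) h
    · exact div_pos ((hsign m).1 h) h
  have hbound : ∀ i, min 0 (d i) ≤ d m / e m * e i ∧ min 0 (d i) ≤ d i - d m / e m * e i := by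
    intro i
    rcases lt_trichotomy (e i) 0 with h | h | h
    · have h1 := (hsign i).2 h
      have h2 : d i ≤ d m / e m * e i := (le_div_iff_of_neg h).1 (hmin i h.ne)
      rw [min_eq_right h1.le]
      exact ⟨h2, by linarith [mul_neg_of_pos_of_neg ha h]⟩
    · simp [h]
    · have h1 := (hsign i).1 h
      have h2 : d m / e m * e i ≤ d i := (le_div_iff₀ h).1 (hmin i h.ne')
      rw [min_eq_left h1.le]
      exact ⟨(mul_pos ha h).le, by linarith⟩
  refine ⟨d m / e m, fun i => by simpa using (hbound i).1, fun i => by simpa using (hbound i).2,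
    Finset.card_lt_card (Finset.ssubset_iff_of_subset ?_ |>.2 ⟨m, ?_, ?_⟩)⟩
  · intro i
    simp only [Finset.mem_filter_univ, Pi.sub_apply, Pi.smul_apply, smul_eq_mul]
    intro hi hdi
    have h0 : e i = 0 := by
      by_contra h
      rcases lt_or_gt_of_ne h with h | h
      · exact ((hsign i).2 h).ne hdi
      · exact ((hsign i).1 h).ne' hdi
    simp [hdi, h0] at hi
  · simp only [Finset.mem_filter_univ]
    intro h
    simp [h] at ha
  · simp [hm]

/-- A descent direction with at most `N + 3` nonzero entries is a conformal sum of at most `N`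
cycles: splitting off a cycle cancels at least one entry, and the last cycle has at least four. Hence
one of these cycles achieves at least the fraction `1 / N` of the decrease. -/
theorem exists_foldable_descent {n : ℕ} (c : Fin n × Fin n → ℝ) (N : ℕ) :
    ∀ d : Fin n × Fin n → ℝ, (otMatrix n).mulVec d = 0 →
      (Finset.univ.filter fun ji => d ji ≠ 0).card ≤ N + 3 → c ⬝ᵥ d < 0 →
      ∃ e : Fin n × Fin n → ℝ, (otMatrix n).mulVec e = 0 ∧ Foldable e ∧
        (∀ ji, min 0 (d ji) ≤ e ji) ∧ N * (c ⬝ᵥ e) ≤ c ⬝ᵥ d := by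
  induction N with
  | zero =>
    intro d hd hcard hc
    have := four_le_card_support hd (by rintro rfl; simp at hc)
    omega
  | succ N ih =>
    intro d hd hcard hc
    obtain ⟨e, he, hne, hfold, hsign⟩ := exists_cycle hd (by rintro rfl; simp at hc)
    obtain ⟨a, h1, h2, h3⟩ := exists_conformal_smul hne hsign
    have hae : (otMatrix n).mulVec (a • e) = 0 := by rw [Matrix.mulVec_smul, he, smul_zero]
    by_cases hcase : ((N + 1 : ℕ) : ℝ) * (c ⬝ᵥ (a • e)) ≤ c ⬝ᵥ d
    · exact ⟨a • e, hae, hfold.smul a, h1, hcase⟩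
    · push_cast at hcase ⊢
      have hN : (0 : ℝ) ≤ N := Nat.cast_nonneg N
      have hsub : c ⬝ᵥ (d - a • e) = c ⬝ᵥ d - c ⬝ᵥ (a • e) := dotProduct_sub _ _ _
      have hlt : (N + 1) * (c ⬝ᵥ (d - a • e)) < N * (c ⬝ᵥ d) := by rw [hsub]; linarith
      have hneg : c ⬝ᵥ (d - a • e) < 0 := by
        have : N * (c ⬝ᵥ d) ≤ 0 := mul_nonpos_of_nonneg_of_nonpos hN hc.le
        by_contra! h
        linarith [mul_nonneg (by linarith : (0 : ℝ) ≤ N + 1) h]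
      obtain ⟨e', he', hfold', hmin', hle'⟩ := ih (d - a • e)
        (by rw [Matrix.mulVec_sub, hd, hae, sub_zero]) (by omega) hneg
      refine ⟨e', he', hfold', fun ji => (le_min (min_le_left _ _) (h2 ji)).trans (hmin' ji), ?_⟩
      -- For `N = 0` the remainder has at most three nonzero entries, hence is no descent direction.
      have hN' : (0 : ℝ) < N := by
        refine hN.lt_of_ne fun h0 => ?_
        rw [← h0, zero_mul] at hle'
        linarith
      have : N * ((N + 1) * (c ⬝ᵥ e')) ≤ N * (c ⬝ᵥ d) :=
        calc N * ((N + 1) * (c ⬝ᵥ e')) = (N + 1) * (N * (c ⬝ᵥ e')) := by ring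
          _ ≤ (N + 1) * (c ⬝ᵥ (d - a • e)) := by gcongr
          _ ≤ _ := hlt.le
      exact le_of_mul_le_mul_left this hN'


/-! ### Random working sets that contain a given cycle -/

/-- The band is cyclic: it consists of the positions with `i - j ∈ {0, …, p - 1}` modulo `n`. -/
theorem inBand_of_modEq {n p i j δ : ℕ} (hi : i < n) (hj : j < n) (hδ : δ < p) (hpn : p ≤ n)
    (h : i ≡ j + δ [MOD n]) : InBand n p (i + 1) (j + 1) := by
  have h' : i = j + δ ∨ i + n = j + δ := by
    rw [Nat.ModEq, Nat.mod_eq_of_lt hi] at h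
    rcases Nat.lt_or_ge (j + δ) n with hlt | hge
    · left; rwa [Nat.mod_eq_of_lt hlt] at h
    · right
      rw [Nat.mod_eq_sub_mod hge, Nat.mod_eq_of_lt (by omega)] at h
      omega
  unfold InBand
  omega

theorem mem_vecSupport_band {n p : ℕ} {π : Equiv.Perm (Fin n) × Equiv.Perm (Fin n)}
    {j i : Fin n} :
    (j, i) ∈ vecSupport ((bandMatrix n p).submatrix π.1 π.2) ↔
      InBand n p (π.1 i + 1) (π.2 j + 1) := by
  refine (Finset.mem_filter_univ _).trans ?_
  simp [bandMatrix, Matrix.vec]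

/-- At least `n (p - 2)` pairs of permutations move the band over the support of a foldable vector:
fold the support into the tridiagonal band, shift that band to one of the `p - 2` bands of width
three contained in the band of width `p`, and rotate by one of the `n` rotations. -/
theorem card_perm_band_le {n p : ℕ} (hp : 3 ≤ p) (hpn : p ≤ n) {e : Fin n × Fin n → ℝ}
    (he : Foldable e) :
    n * (p - 2) ≤ Nat.card {π : Equiv.Perm (Fin n) × Equiv.Perm (Fin n) //
      ∀ ji, e ji ≠ 0 → ji ∈ vecSupport ((bandMatrix n p).submatrix π.1 π.2)} := by
  have : NeZero n := ⟨by omega⟩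
  obtain ⟨σ, τ, h⟩ := he
  let sh : Fin (p - 2) → Fin n := fun t => ⟨t + 1, by omega⟩
  let F : Fin n × Fin (p - 2) → {π : Equiv.Perm (Fin n) × Equiv.Perm (Fin n) //
      ∀ ji, e ji ≠ 0 → ji ∈ vecSupport ((bandMatrix n p).submatrix π.1 π.2)} := fun at' =>
    ⟨(σ.trans (Equiv.addRight (at'.1 + sh at'.2)), τ.trans (Equiv.addRight at'.1)), by
      rintro ⟨j, i⟩ hji
      obtain ⟨h1, h2⟩ := h j i hji
      obtain ⟨a, t⟩ := at'
      have ht := t.2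
      rw [mem_vecSupport_band]
      -- The offset lies in `{t, t + 1, t + 2}`, so it is nonnegative and less than `p`.
      refine inBand_of_modEq (δ := σ i + (t + 1) - τ j) (Fin.is_lt _) (Fin.is_lt _) (by omega) hpn ?_
      have hL : ((σ.trans (Equiv.addRight (a + sh t)) i : Fin n) : ℕ) ≡ σ i + (a + (t + 1)) [MOD n] := by
        simp [Fin.val_add, Nat.ModEq, sh, add_assoc]
      have hR : ((τ.trans (Equiv.addRight a) j : Fin n) : ℕ) ≡ τ j + a [MOD n] := by
        simp [Fin.val_add, Nat.ModEq]
      refine hL.trans ?_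
      refine Nat.ModEq.trans ?_ (hR.add_right _).symm
      rw [show τ j + (a : ℕ) + (σ i + (t + 1) - τ j) = σ i + (a + (t + 1)) by omega]⟩
  -- The image of a column determines the rotation, and then the image of a row determines the shift.
  have hF : Function.Injective F := by
    rintro ⟨a, t⟩ ⟨a', t'⟩ heq
    have h0 := congrArg Subtype.val heq
    have h2 := DFunLike.congr_fun (congrArg Prod.snd h0) 0
    have h1 := DFunLike.congr_fun (congrArg Prod.fst h0) 0
    have ha : a = a' := by simpa [F] using h2
    subst ha
    have ht : sh t = sh t' := by simpa [F] using h1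
    have ht' : (t : ℕ) + 1 = t' + 1 := congrArg Fin.val ht
    rw [Prod.mk.injEq]
    exact ⟨rfl, Fin.ext (by omega)⟩
  simpa using Nat.card_le_card_of_injective F hF

theorem sum_bandLaw_ge {n p : ℕ} (hp : 3 ≤ p) (hpn : p ≤ n) {e : Fin n × Fin n → ℝ}
    (he : Foldable e) (T : Finset (Finset (Fin n × Fin n)))
    (hT : ∀ S, (∀ ji, e ji ≠ 0 → ji ∈ S) → S ∈ T) :
    n * ((p : ℝ) - 2) / (n.factorial : ℝ) ^ 2 ≤ ∑ S ∈ T, (bandLaw n p S).toReal := by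
  classical
  rw [← ENNReal.toReal_sum fun S _ => PMF.apply_ne_top _ _, ← PMF.toOuterMeasure_apply_finset,
    bandLaw, PMF.toOuterMeasure_map_apply, PMF.toOuterMeasure_uniformOfFintype_apply,
    ENNReal.toReal_div, ENNReal.toReal_natCast, ENNReal.toReal_natCast, Fintype.card_prod,
    Fintype.card_perm, Fintype.card_fin, Nat.cast_mul n.factorial, ← sq]
  gcongr
  have h1 : n * (p - 2) ≤ _ := (card_perm_band_le hp hpn he).trans
    (Nat.card_le_card_of_injective (fun π => (⟨π.1, hT _ π.2⟩ :
      ((fun π : Equiv.Perm (Fin n) × Equiv.Perm (Fin n) =>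
        vecSupport ((bandMatrix n p).submatrix π.1 π.2)) ⁻¹' (T : Set _))))
      fun a b hab => Subtype.ext (by simpa using hab))
  rw [Nat.card_eq_fintype_card] at h1
  have h2 : ((n * (p - 2) : ℕ) : ℝ) = n * ((p : ℝ) - 2) := by
    rw [Nat.cast_mul, Nat.cast_sub (by omega)]
    norm_num
  rw [← h2]
  exact_mod_cast h1

theorem mixedProb_toReal_ge {n m p : ℕ} (hm : m ≤ n) {s : ℝ} (hs : 0 ≤ s)
    (S : Finset (Fin n × Fin n)) :
    s * (bandLaw n p S).toReal ≤ (mixedProb n m p hm s S).toReal := by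
  rw [mixedProb, ENNReal.toReal_add (ENNReal.mul_ne_top ENNReal.ofReal_ne_top (PMF.apply_ne_top _ _))
    (ENNReal.mul_ne_top ENNReal.ofReal_ne_top (PMF.apply_ne_top _ _)), ENNReal.toReal_mul,
    ENNReal.toReal_ofReal hs]
  exact le_add_of_nonneg_right ENNReal.toReal_nonneg

/-! ### The expected decrease at a fixed point -/

/-- The lower bound for the constant of the expected Gauss–Southwell-`q` rule. -/
noncomputable def gaussSouthwellConst (n p : ℕ) (s : ℝ) : ℝ :=
  s * n * ((p : ℝ) - 2) / (((n : ℝ) ^ 2 - 3) * (n.factorial : ℝ) ^ 2)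

theorem gaussSouthwellConst_pos {n p : ℕ} {s : ℝ} (hp : 3 ≤ p) (hpn : p ≤ n) (hs : 0 < s) :
    0 < gaussSouthwellConst n p s := by
  have h1 : (3 : ℝ) ≤ p := by exact_mod_cast hp
  have h2 : (p : ℝ) ≤ n := by exact_mod_cast hpn
  have h3 : (0 : ℝ) < n.factorial := by exact_mod_cast n.factorial_pos
  have h4 : (0 : ℝ) < (n : ℝ) ^ 2 - 3 := by nlinarith
  have h5 : (0 : ℝ) < (p : ℝ) - 2 := by linarith
  have h6 : (0 : ℝ) < n := by linarith
  unfold gaussSouthwellConst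
  positivity

theorem gaussSouthwellConst_le_one {n p : ℕ} {s : ℝ} (hp : 3 ≤ p) (hpn : p ≤ n)
    (hs1 : s ≤ 1) : gaussSouthwellConst n p s ≤ 1 := by
  have h1 : (3 : ℝ) ≤ p := by exact_mod_cast hp
  have h2 : (p : ℝ) ≤ n := by exact_mod_cast hpn
  have h3 : (1 : ℝ) ≤ n.factorial := by exact_mod_cast n.factorial_pos
  have h4 : (0 : ℝ) < (n : ℝ) ^ 2 - 3 := by nlinarith
  have h5 : (0 : ℝ) ≤ n * ((p : ℝ) - 2) := mul_nonneg (by linarith) (by linarith)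
  refine div_le_one_of_le₀ ?_ (by positivity)
  calc s * n * ((p : ℝ) - 2) = s * (n * ((p : ℝ) - 2)) := by ring
    _ ≤ 1 * (n * ((p : ℝ) - 2)) := by gcongr
    _ ≤ ((n : ℝ) ^ 2 - 3) * 1 := by nlinarith
    _ ≤ ((n : ℝ) ^ 2 - 3) * (n.factorial : ℝ) ^ 2 := by
      gcongr
      exact one_le_pow₀ h3

/-- The Gauss–Southwell-`q` inequality at a fixed feasible point, the average being taken over the
law of the working set: with sufficient probability the working set contains the support of the
cycle that achieves the fraction `1 / (n² - 3)` of the optimal decrease. -/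
theorem sum_mixedProb_mul_q_le {n m p : ℕ} (hm : m ≤ n) (hp : 3 ≤ p) (hpn : p ≤ n) {s : ℝ}
    (hs : 0 < s) (c : Fin n × Fin n → ℝ) {b : Fin n ⊕ Fin n → ℝ} {x : Fin n × Fin n → ℝ}
    (hx : x ∈ feasibleSet (otMatrix n) b) :
    ∑ S, (mixedProb n m p hm s S).toReal * q (otMatrix n) c x S ≤
      gaussSouthwellConst n p s * q (otMatrix n) c x Finset.univ := by
  classical
  have hK := isCompact_feasibleSet_otMatrix b
  have hle : ∀ S, (mixedProb n m p hm s S).toReal * q (otMatrix n) c x S ≤ 0 := fun S =>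
    mul_nonpos_of_nonneg_of_nonpos ENNReal.toReal_nonneg (q_nonpos hK hx)
  obtain ⟨d, hd⟩ := argminDirections_nonempty (c := c) (I := Finset.univ) hK hx
  rw [q_eq_of_mem_argminDirections hd]
  rcases le_or_gt 0 (c ⬝ᵥ d) with h0 | h0
  · exact (Finset.sum_nonpos fun S _ => hle S).trans
      (mul_nonneg (gaussSouthwellConst_pos hp hpn hs).le h0)
  have hn : 9 ≤ n ^ 2 := by nlinarith
  obtain ⟨e, he, hfold, hmin, hdec⟩ := exists_foldable_descent c (n ^ 2 - 3) d hd.1.2.1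
    ((Finset.card_le_univ _).trans (by simp [← sq]; omega)) h0
  rw [Nat.cast_sub (by omega)] at hdec
  push_cast at hdec
  have hN : (0 : ℝ) < (n : ℝ) ^ 2 - 3 := by
    have : (9 : ℝ) ≤ (n : ℝ) ^ 2 := by exact_mod_cast hn
    linarith
  have hce : c ⬝ᵥ e ≤ 0 := by
    by_contra! h
    linarith [mul_pos hN h]
  let T : Finset (Finset (Fin n × Fin n)) := Finset.univ.filter fun S => ∀ ji, e ji ≠ 0 → ji ∈ S
  have hqT : ∀ S ∈ T, q (otMatrix n) c x S ≤ c ⬝ᵥ e := fun S hS => by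
    refine q_le hK hx ⟨fun ji => ?_, he, fun ji hji => ?_⟩
    · have h1 := hx.2 ji
      have h2 := hd.1.1 ji
      have h3 := hmin ji
      simp only [Pi.zero_apply, Pi.add_apply] at h1 h2 ⊢
      rcases min_choice 0 (d ji) with h | h <;> rw [h] at h3 <;> linarith
    · by_contra h
      exact hji ((Finset.mem_filter.1 hS).2 ji h)
  have hprob : s * (n * ((p : ℝ) - 2) / (n.factorial : ℝ) ^ 2) ≤
      ∑ S ∈ T, (mixedProb n m p hm s S).toReal := by
    refine (mul_le_mul_of_nonneg_left (sum_bandLaw_ge hp hpn hfold T fun S hS => ?_) hs.le).trans ?_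
    · simpa [T] using hS
    · rw [Finset.mul_sum]
      exact Finset.sum_le_sum fun S _ => mixedProb_toReal_ge hm hs.le S
  have hw : 0 ≤ s * (n * ((p : ℝ) - 2) / (n.factorial : ℝ) ^ 2) := by
    have : (3 : ℝ) ≤ p := by exact_mod_cast hp
    have : (0 : ℝ) ≤ (p : ℝ) - 2 := by linarith
    positivity
  calc ∑ S, (mixedProb n m p hm s S).toReal * q (otMatrix n) c x S
      ≤ ∑ S ∈ T, (mixedProb n m p hm s S).toReal * q (otMatrix n) c x S := by
        rw [← Finset.sum_filter_add_sum_filter_not Finset.univ fun S => ∀ ji, e ji ≠ 0 → ji ∈ S]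
        exact add_le_of_nonpos_right (Finset.sum_nonpos fun S _ => hle S)
    _ ≤ ∑ S ∈ T, (mixedProb n m p hm s S).toReal * (c ⬝ᵥ e) :=
        Finset.sum_le_sum fun S hS => mul_le_mul_of_nonneg_left (hqT S hS) ENNReal.toReal_nonneg
    _ = (∑ S ∈ T, (mixedProb n m p hm s S).toReal) * (c ⬝ᵥ e) := by rw [Finset.sum_mul]
    _ ≤ s * (n * ((p : ℝ) - 2) / (n.factorial : ℝ) ^ 2) * (c ⬝ᵥ e) :=
        mul_le_mul_of_nonpos_right hprob hce
    _ ≤ s * (n * ((p : ℝ) - 2) / (n.factorial : ℝ) ^ 2) * (c ⬝ᵥ d / ((n : ℝ) ^ 2 - 3)) := by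
        gcongr
        rwa [le_div_iff₀ hN, mul_comm]
    _ = gaussSouthwellConst n p s * (c ⬝ᵥ d) := by
        have : (n.factorial : ℝ) ≠ 0 := by exact_mod_cast n.factorial_ne_zero
        unfold gaussSouthwellConst
        field_simp


/-! ### Conditional expectation and convergence -/

section Stochastic

variable {κ ι Ω : Type*} [Fintype ι] {A : Matrix κ ι ℝ} {b : κ → ℝ} {c : ι → ℝ}

theorem exists_abs_dotProduct_le (hK : IsCompact (feasibleSet A b)) (c : ι → ℝ) :
    ∃ B, ∀ y ∈ feasibleSet A b, |c ⬝ᵥ y| ≤ B :=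
  hK.exists_bound_of_continuousOn (continuous_cost c).continuousOn

theorem exists_abs_q_le (hK : IsCompact (feasibleSet A b)) (c : ι → ℝ) :
    ∃ B, ∀ y ∈ feasibleSet A b, ∀ I, |q A c y I| ≤ B := by
  obtain ⟨B, hB⟩ := exists_abs_dotProduct_le hK c
  refine ⟨B + B, fun y hy I => ?_⟩
  obtain ⟨d, hd⟩ := argminDirections_nonempty (c := c) (I := I) hK hy
  have h : c ⬝ᵥ d = c ⬝ᵥ (y + d) - c ⬝ᵥ y := by rw [dotProduct_add]; ring
  rw [q_eq_of_mem_argminDirections hd, h]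
  exact (abs_sub _ _).trans (add_le_add (hB _ (add_mem_feasibleSet hy hd.1)) (hB _ hy))

theorem measurable_q_comp {m : MeasurableSpace Ω} (hK : IsCompact (feasibleSet A b)) (c : ι → ℝ)
    {y : Ω → ι → ℝ} (hy : Measurable y) (hfeas : ∀ ω, y ω ∈ feasibleSet A b) (S : Finset ι) :
    Measurable fun ω => q A c (y ω) S := by
  have h : Measurable fun ω => (⟨y ω, hfeas ω⟩ : feasibleSet A b) := hy.subtype_mk
  simpa [Function.comp_def] using (measurable_q hK c S).comp h

theorem q_eq_sum_indicator (y : Ω → ι → ℝ) (J : Ω → Finset ι) :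
    (fun ω => q A c (y ω) (J ω)) =
      ∑ S, (fun ω => q A c (y ω) S) * Set.indicator {ω | J ω = S} 1 := by
  classical
  ext ω
  simp [Finset.sum_apply, Set.indicator_apply]

variable {mΩ : MeasurableSpace Ω} {μ : Measure Ω}

theorem integrable_q_mul_indicator [IsProbabilityMeasure μ] (hK : IsCompact (feasibleSet A b))
    {y : Ω → ι → ℝ} (hy : Measurable y) (hfeas : ∀ ω, y ω ∈ feasibleSet A b)
    {J : Ω → Finset ι} (hJ : Measurable[mΩ, ⊤] J) (S : Finset ι) :
    Integrable ((fun ω => q A c (y ω) S) * Set.indicator {ω | J ω = S} 1) μ := by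
  obtain ⟨B, hB⟩ := exists_abs_q_le hK c
  have hmeas : MeasurableSet[mΩ] {ω | J ω = S} := hJ (t := {S}) trivial
  exact ((integrable_const 1).indicator hmeas).bdd_mul
    (measurable_q_comp hK c hy hfeas S).aestronglyMeasurable
    (ae_of_all _ fun ω => hB _ (hfeas ω) S)

theorem integrable_q [IsProbabilityMeasure μ] (hK : IsCompact (feasibleSet A b))
    {y : Ω → ι → ℝ} (hy : Measurable y) (hfeas : ∀ ω, y ω ∈ feasibleSet A b)
    {J : Ω → Finset ι} (hJ : Measurable[mΩ, ⊤] J) :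
    Integrable (fun ω => q A c (y ω) (J ω)) μ := by
  rw [q_eq_sum_indicator]
  exact integrable_finsetSum' _ fun S _ => integrable_q_mul_indicator hK hy hfeas hJ S

/-- If the working set is independent of the past, conditioning on the past averages the value of
the subproblem over the law of the working set. -/
theorem condExp_q_eq [IsProbabilityMeasure μ] {m : MeasurableSpace Ω} (hm : m ≤ mΩ)
    (hK : IsCompact (feasibleSet A b)) {y : Ω → ι → ℝ} (hy : Measurable[m] y)
    (hfeas : ∀ ω, y ω ∈ feasibleSet A b) {J : Ω → Finset ι}
    (hJ : Measurable[mΩ, ⊤] J) (hindep : Indep (MeasurableSpace.comap J ⊤) m μ) :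
    μ[fun ω => q A c (y ω) (J ω) | m] =ᵐ[μ]
      fun ω => ∑ S, (μ {ω | J ω = S}).toReal * q A c (y ω) S := by
  have hy' : Measurable[mΩ] y := hy.mono hm le_rfl
  have hS : ∀ S, μ[(fun ω => q A c (y ω) S) * Set.indicator {ω | J ω = S} 1 | m] =ᵐ[μ]
      fun ω => (μ {ω | J ω = S}).toReal * q A c (y ω) S := by
    intro S
    have hmeas : MeasurableSet[mΩ] {ω | J ω = S} := hJ (t := {S}) trivial
    have hind : Integrable (Set.indicator {ω | J ω = S} (1 : Ω → ℝ)) μ :=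
      (integrable_const 1).indicator hmeas
    have h1 := condExp_mul_of_stronglyMeasurable_left
      (measurable_q_comp hK c hy hfeas S).stronglyMeasurable
      (integrable_q_mul_indicator (μ := μ) hK hy' hfeas hJ S) hind
    have h2 : μ[Set.indicator {ω | J ω = S} (1 : Ω → ℝ) | m] =ᵐ[μ]
        fun _ => μ[Set.indicator {ω | J ω = S} (1 : Ω → ℝ)] :=
      condExp_indep_eq hJ.comap_le hm (stronglyMeasurable_one.indicator ⟨{S}, trivial, rfl⟩) hindep
    filter_upwards [h1, h2] with ω h1 h2
    rw [h1, Pi.mul_apply, h2, integral_indicator_one hmeas, mul_comm]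
    rfl
  rw [q_eq_sum_indicator]
  refine (condExp_finsetSum (fun S _ => integrable_q_mul_indicator hK hy' hfeas hJ S) m).trans ?_
  filter_upwards [ae_all_iff.2 hS] with ω hω
  rw [Finset.sum_apply]
  exact Finset.sum_congr rfl fun S _ => hω S

omit [Fintype ι] in
theorem measurable_history (x : ℕ → Ω → ι → ℝ) (k : ℕ) : Measurable[history x k] (x k) :=
  (comap_measurable (x k)).mono
    (le_iSup₂_of_le k (Finset.self_mem_range_succ k) le_rfl) le_rfl

omit [Fintype ι] in
theorem history_le {x : ℕ → Ω → ι → ℝ} (hx : ∀ k, Measurable (x k)) (k : ℕ) :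
    history x k ≤ mΩ :=
  iSup₂_le fun j _ => (hx j).comap_le

/-- Under the expected Gauss–Southwell-`q` rule the expected optimality gap contracts by the factor
`1 - v`, because `-q(x; 𝒩)` is the optimality gap at `x`. The gap is nonincreasing along each
trajectory, so convergence of its mean to zero forces almost sure convergence. -/
theorem ExpectedGaussSouthwellQ.convergence [IsProbabilityMeasure μ]
    (hK : IsCompact (feasibleSet A b)) {x : ℕ → Ω → ι → ℝ} {I : ℕ → Ω → Finset ι} {v : ℝ}
    (hGS : ExpectedGaussSouthwellQ μ A c x I v) (hx : ∀ k, Measurable (x k))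
    (hfeas : ∀ k ω, x k ω ∈ feasibleSet A b)
    (hstep : ∀ k ω, c ⬝ᵥ x (k + 1) ω = c ⬝ᵥ x k ω + q A c (x k ω) (I k ω))
    {xstar : ι → ℝ} (hs : xstar ∈ optimalSet A b c) :
    (∀ᵐ ω ∂μ, Tendsto (fun k => c ⬝ᵥ (x k ω - xstar)) atTop (𝓝 0)) ∧
    (∀ k, Integrable (fun ω => c ⬝ᵥ (x k ω - xstar)) μ) ∧
    (∀ k, ∫ ω, c ⬝ᵥ (x k ω - xstar) ∂μ ≤ (1 - v) ^ k * ∫ ω, c ⬝ᵥ (x 0 ω - xstar) ∂μ) ∧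
    Tendsto (fun k => ∫ ω, c ⬝ᵥ (x k ω - xstar) ∂μ) atTop (𝓝 0) := by
  obtain ⟨hv0, hv1, hGS⟩ := hGS
  obtain ⟨B, hB⟩ := exists_abs_dotProduct_le hK c
  have hnonneg : ∀ k ω, 0 ≤ c ⬝ᵥ (x k ω - xstar) := fun k ω => by
    rw [dotProduct_sub]
    exact sub_nonneg.2 (hs.2 _ (hfeas k ω))
  have hint : ∀ k, Integrable (fun ω => c ⬝ᵥ (x k ω - xstar)) μ := fun k => by
    refine Integrable.of_bound (C := B + B)
      ((continuous_cost c).measurable.comp ((hx k).sub_const xstar)).aestronglyMeasurable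
      (ae_of_all _ fun ω => ?_)
    rw [dotProduct_sub]
    exact (abs_sub _ _).trans (add_le_add (hB _ (hfeas k ω)) (hB _ hs.1))
  have hsucc : ∀ k ω, c ⬝ᵥ (x (k + 1) ω - xstar) =
      c ⬝ᵥ (x k ω - xstar) + q A c (x k ω) (I k ω) := fun k ω => by
    rw [dotProduct_sub, dotProduct_sub, hstep]
    ring
  have hcontr : ∀ k, ∫ ω, c ⬝ᵥ (x (k + 1) ω - xstar) ∂μ ≤
      (1 - v) * ∫ ω, c ⬝ᵥ (x k ω - xstar) ∂μ := fun k => by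
    have h1 : ∫ ω, q A c (x k ω) (I k ω) ∂μ ≤ -(v * ∫ ω, c ⬝ᵥ (x k ω - xstar) ∂μ) := by
      rw [← integral_condExp (history_le hx k), ← integral_const_mul, ← integral_neg]
      refine integral_mono_ae integrable_condExp ((hint k).const_mul v).neg ?_
      filter_upwards [(hGS k).2] with ω hω
      rwa [q_univ_eq (hfeas k ω) hs, mul_neg] at hω
    simp_rw [hsucc]
    rw [integral_add (hint k) (hGS k).1]
    linarith
  have hgeom : ∀ k, ∫ ω, c ⬝ᵥ (x k ω - xstar) ∂μ ≤
      (1 - v) ^ k * ∫ ω, c ⬝ᵥ (x 0 ω - xstar) ∂μ := fun k => by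
    induction k with
    | zero => simp
    | succ k ih =>
      refine (hcontr k).trans ?_
      rw [pow_succ', mul_assoc]
      exact mul_le_mul_of_nonneg_left ih (by linarith)
  have hlim : Tendsto (fun k => ∫ ω, c ⬝ᵥ (x k ω - xstar) ∂μ) atTop (𝓝 0) := by
    refine squeeze_zero (fun k => integral_nonneg (hnonneg k)) hgeom ?_
    simpa using (tendsto_pow_atTop_nhds_zero_of_lt_one (by linarith : 0 ≤ 1 - v)
      (by linarith)).mul_const (∫ ω, c ⬝ᵥ (x 0 ω - xstar) ∂μ)
  refine ⟨?_, hint, hgeom, hlim⟩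
  refine tendsto_of_integral_tendsto_of_antitone (F := fun _ => 0) hint (integrable_zero _ _ _)
    (by simpa using hlim) (ae_of_all _ fun ω => antitone_nat_of_succ_le fun k => ?_)
    (ae_of_all _ fun ω k => hnonneg k ω)
  rw [hsucc]
  exact add_le_of_nonpos_right (q_nonpos hK (hfeas k ω))

end Stochastic

end RBCD

/-! ### The algorithm -/

theorem mainTheorem6 {Ω : Type*} [MeasurableSpace Ω] (μ : Measure Ω) [IsProbabilityMeasure μ]
    (n m p : ℕ) (hm : m < n) (hp : 3 ≤ p) (hpn : p ≤ n) (s : ℝ) (hs : 0 < s) (hs1 : s ≤ 1)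
    (C : Matrix (Fin n) (Fin n) ℝ) (r₁ r₂ : Fin n → ℝ)
    (x : ℕ → Ω → Fin n × Fin n → ℝ) (I : ℕ → Ω → Finset (Fin n × Fin n))
    (d : ℕ → Ω → Fin n × Fin n → ℝ)
    (hrun : RBCD.IsRBCDSDB μ m p hm.le s C r₁ r₂ x I d) :
    ∃ v : ℝ,
      s * n * ((p : ℝ) - 2) / (((n : ℝ) ^ 2 - 3) * (n.factorial : ℝ) ^ 2) ≤ v ∧
      RBCD.ExpectedGaussSouthwellQ μ (RBCD.otMatrix n) C.vec x I v ∧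
      ∀ xstar ∈ RBCD.optimalSet (RBCD.otMatrix n) (RBCD.otRhs r₁ r₂) C.vec,
        (∀ᵐ ω ∂μ, Tendsto (fun k => C.vec ⬝ᵥ (x k ω - xstar)) atTop (𝓝 0)) ∧
        (∀ k, Integrable (fun ω => C.vec ⬝ᵥ (x k ω - xstar)) μ) ∧
        (∀ k, ∫ ω, C.vec ⬝ᵥ (x k ω - xstar) ∂μ
            ≤ (1 - v) ^ k * ∫ ω, C.vec ⬝ᵥ (x 0 ω - xstar) ∂μ) ∧
        Tendsto (fun k => ∫ ω, C.vec ⬝ᵥ (x k ω - xstar) ∂μ) atTop (𝓝 0) := by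
  have hK := RBCD.isCompact_feasibleSet_otMatrix (RBCD.otRhs r₁ r₂)
  have hfeas : ∀ k ω, x k ω ∈ RBCD.feasibleSet (RBCD.otMatrix n) (RBCD.otRhs r₁ r₂) := by
    intro k ω
    induction k with
    | zero => exact hrun.init ω
    | succ k ih =>
      rw [hrun.update]
      exact RBCD.add_mem_feasibleSet ih (hrun.step k ω).1
  have hGS : RBCD.ExpectedGaussSouthwellQ μ (RBCD.otMatrix n) C.vec x I
      (RBCD.gaussSouthwellConst n p s) := by
    refine ⟨RBCD.gaussSouthwellConst_pos hp hpn hs, RBCD.gaussSouthwellConst_le_one hp hpn hs1,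
      fun k => ⟨RBCD.integrable_q hK (hrun.measurable_x k) (hfeas k) (hrun.measurable_I k), ?_⟩⟩
    filter_upwards [RBCD.condExp_q_eq (c := C.vec) (RBCD.history_le hrun.measurable_x k) hK
      (RBCD.measurable_history x k) (hfeas k) (hrun.measurable_I k) (hrun.indep_I k)] with ω hω
    simp only [hω, hrun.law_I]
    exact RBCD.sum_mixedProb_mul_q_le hm.le hp hpn hs C.vec (hfeas k ω)
  refine ⟨RBCD.gaussSouthwellConst n p s, le_rfl, hGS, fun xstar hxstar =>
    hGS.convergence hK hrun.measurable_x hfeas (fun k ω => ?_) hxstar⟩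
  rw [hrun.update, dotProduct_add, RBCD.q_eq_of_mem_argminDirections (hrun.step k ω)]
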